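/- Let $G$ be a finite group and let $\alpha:G\times G\to\mathbb{C}^\times$ be a cocycle, i.e. $\alpha(x,y)\alpha(xy,z)=\alpha(x,yz)\alpha(y,z)$ for all $x,y,z\in G$. An $\alpha$-representation of $G$ of dimension $d_\rho$ is a map $\rho:G\to\mathrm{GL}(\mathbb{C}^{d_\rho})$ with $\rho(g)\rho(h)=\alpha(g,h)\rho(gh)$ for all $g,h\in G$; it is irreducible if $d_\rho>0$ and $0$ and $\mathbb{C}^{d_\rho}$ are the only subspaces invariant under all $\rho(g)$, and $\rho,\sigma$ are equivalent if $\rho=T\sigma T^{-1}$ for some invertible linear map $T$. Let $R$ be a complete set of irreducible $\alpha$-representations (every member of $R$ is irreducible, and every irreducible $\alpha$-representation is equivalent to exactly one member of $R$), and suppose that each $\rho\in R$ is unitary, i.e. $\rho(g)^*=\rho(g)^{-1}$ for all $g\in G$. For $\nu:G\to\mathbb{C}$ let $M_\alpha(\nu)\in\mathbb{C}^{G\times G}$ be the $(G,\alpha)$-matrix and $(F_\alpha\nu)_\rho$ the $\alpha$-Fourier transform of $\nu$ at $\rho$, $$M_\alpha(\nu)_{g,h}=\frac{\nu(g^{-1}h)}{\alpha(g,g^{-1}h)},\qquad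 (F_\alpha\nu)_\rho=\sum_{a\in G}\frac{\nu(a)\,\rho(a^{-1})}{\alpha(a,a^{-1})\alpha(1,1)},$$ and let $E$ be the matrix with rows indexed by $G$ which consists of the blocks of columns $$E_{\rho,k}=\sqrt{\frac{d_\rho}{|G|}}\,[\rho_{k1},\rho_{k2},\ldots,\rho_{kd_\rho}],\qquad \rho\in R,\ 1\le k\le d_\rho,$$ where $\rho_{kl}\in\mathbb{C}^G$ is the function $g\mapsto\rho(g)_{kl}$. Then $R$ is finite, $E$ is unitary ($E^*E=I$ and $EE^*=I$), and for every $\nu:G\to\mathbb{C}$ the matrix $\overline{E}^*M_\alpha(\nu)\overline{E}$ is block diagonal with respect to the blocks $(\rho,k)$, $\rho\in R$, $1\le k\le d_\rho$, the diagonal block at $(\rho,k)$ being $\left((F_\alpha\nu)_\rho\right)^T$. That is, $$\overline{E}^*M_\alpha(\nu)\overline{E}=\mathrm{diag}\left(\left((F_\alpha\nu)_\rho\right)^T:\rho\in R,\ 1\le k\le d_\rho\right),$$ so each block $\left((F_\alpha\nu)_\rho\right)^T$ appears $d_\rho$ times, and the $(G,\alpha)$-matrices are simultaneously unitarily block diagonalised.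 -/

import Mathlib

open scoped Matrix ComplexConjugate Classical

/-- A `2`-cocycle (multiplier) of `G` with values in the nonzero complex numbers. -/
def IsCocycle {G : Type*} [Group G] (α : G → G → ℂˣ) : Prop :=
  ∀ x y z : G, α x y * α (x * y) z = α x (y * z) * α y z

/-- A projective representation `G → GL(ℂ^d)` of `G` with cocycle `α`. -/
structure ProjRep {G : Type*} [Group G] (α : G → G → ℂˣ) where
  /-- the dimension `d` -/
  dim : ℕ
  /-- the invertible matrix by which `g` acts -/
  mat : G → Matrix.GeneralLinearGroup (Fin dim) ℂ
  mat_mul : ∀ g h : G,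
    (mat g : Matrix (Fin dim) (Fin dim) ℂ) * (mat h : Matrix (Fin dim) (Fin dim) ℂ) =
      (α g h : ℂ) • (mat (g * h) : Matrix (Fin dim) (Fin dim) ℂ)

namespace ProjRep

variable {G : Type*} [Group G] {α : G → G → ℂˣ}

/-- The matrix `ρ(g)`. -/
def toMatrix (ρ : ProjRep α) (g : G) : Matrix (Fin ρ.dim) (Fin ρ.dim) ℂ :=
  (ρ.mat g : Matrix (Fin ρ.dim) (Fin ρ.dim) ℂ)

/-- `ρ` is unitary: `ρ(g)^* = ρ(g)⁻¹` for all `g`. -/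
def IsUnitary (ρ : ProjRep α) : Prop :=
  ∀ g : G, (ρ.toMatrix g)ᴴ = (ρ.toMatrix g)⁻¹

/-- `ρ` is irreducible: the space `ℂ^d` is nonzero and its only `G`-invariant subspaces are
`0` and itself. -/
def IsIrreducible (ρ : ProjRep α) : Prop :=
  0 < ρ.dim ∧ ∀ W : Submodule ℂ (Fin ρ.dim → ℂ),
    (∀ g : G, ∀ w ∈ W, ρ.toMatrix g *ᵥ w ∈ W) → W = ⊥ ∨ W = ⊤

/-- Equivalence of two representations with the same cocycle: `ρ = T σ T⁻¹` for an
invertible linear map `T`. -/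
def Equivalent (ρ σ : ProjRep α) : Prop :=
  ∃ T : (Fin σ.dim → ℂ) ≃ₗ[ℂ] (Fin ρ.dim → ℂ),
    ∀ (g : G) (v : Fin σ.dim → ℂ), T (σ.toMatrix g *ᵥ v) = ρ.toMatrix g *ᵥ T v

/-- `R` is a complete set of irreducible representations for the cocycle `α`: every
irreducible representation occurs exactly once in `R` up to equivalence. -/
def IsCompleteSet (R : Set (ProjRep α)) : Prop :=
  (∀ ρ ∈ R, ρ.IsIrreducible) ∧
    ∀ σ : ProjRep α, σ.IsIrreducible → ∃! ρ : ProjRep α, ρ ∈ R ∧ ρ.Equivalent σ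

/-- The `α`-Fourier transform of `f` at `ρ`. -/
noncomputable def fourier [Fintype G] (f : G → ℂ) (ρ : ProjRep α) :
    Matrix (Fin ρ.dim) (Fin ρ.dim) ℂ :=
  ∑ a : G, (f a / ((α a a⁻¹ : ℂ) * (α 1 1 : ℂ))) • ρ.toMatrix a⁻¹

/-- The matrix `E = [E_{ρ,k} : ρ ∈ R, 1 ≤ k ≤ d_ρ]`: the block of columns `E_{ρ,k}` is
`√(d_ρ / |G|) [ρ_{k1}, …, ρ_{k d_ρ}]`. The column index `⟨⟨ρ, k⟩, l⟩` stands for the `l`-th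
column of the block `E_{ρ,k}`. -/
noncomputable def coeffMatrix [Fintype G] (R : Set (ProjRep α)) :
    Matrix G (Σ p : (Σ ρ : R, Fin ρ.1.dim), Fin p.1.1.dim) ℂ :=
  fun g c => (Real.sqrt ((c.1.1.1.dim : ℝ) / (Fintype.card G : ℝ)) : ℂ) *
    c.1.1.1.toMatrix g c.1.2 c.2

end ProjRep

/-- The `(G,α)`-matrix `M_α(ν)`. -/
noncomputable def twistedGroupMatrix {G : Type*} [Group G] (α : G → G → ℂˣ) (ν : G → ℂ) :
    Matrix G G ℂ :=
  fun g h => ν (g⁻¹ * h) / (α g (g⁻¹ * h) : ℂ)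

namespace IsCocycle

variable {G : Type*} [Group G] {α : G → G → ℂˣ}

/-! Unitarity of $E$ is Schur orthogonality plus completeness. In $\sum_g \rho(g)^{-1}X\sigma(g)$
the cocycle factors cancel, so Schur's lemma gives $E^*E=I$ (`conjTranspose_mul_coeffMatrix`). For
$EE^*=I$, functions orthogonal to all coefficients form a space stable under twisted translation. If
nonzero, it contains a copy of some $\rho\in R$, whose functions are combinations of coefficients of
$\rho$ and hence orthogonal to themselves (`eq_zero_of_orthogonal`). Since unitarity forces
$|\alpha|=1$, conjugating $\rho(g)\rho(a)=\alpha(g,a)\rho(ga)$ gives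
$M_\alpha(\nu)\overline{E_{\rho,k}}=\overline{E_{\rho,k}}\,((F_\alpha\nu)_\rho)^T$
(`twistedGroupMatrix_mul_conj`); orthonormality then yields the blocks. -/

theorem one_left (hα : IsCocycle α) (z : G) : α 1 z = α 1 1 := by
  have h := hα 1 1 z
  simp only [one_mul] at h
  exact (mul_right_cancel h).symm

theorem one_right (hα : IsCocycle α) (x : G) : α x 1 = α 1 1 := by
  have h := hα x 1 1
  simp only [mul_one] at h
  exact mul_left_cancel h

end IsCocycle

/-! ### Twisted translation on functions -/

/-- Twisted right translation of functions on `G`: `(T_g f)(x) = α(x,g) f(xg)`. -/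
noncomputable def twistedTranslation {G : Type*} [Group G] (α : G → G → ℂˣ) (g : G) :
    (G → ℂ) →ₗ[ℂ] (G → ℂ) where
  toFun f x := (α x g : ℂ) * f (x * g)
  map_add' f₁ f₂ := by ext x; simp [mul_add]
  map_smul' c f := by ext x; simp [mul_left_comm]

section Translation

variable {G : Type*} [Group G] {α : G → G → ℂˣ}

theorem twistedTranslation_apply (g : G) (f : G → ℂ) (x : G) :
    twistedTranslation α g f x = (α x g : ℂ) * f (x * g) := rfl

theorem twistedTranslation_comp (hα : IsCocycle α) (g h : G) (f : G → ℂ) :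
    twistedTranslation α g (twistedTranslation α h f) =
      (α g h : ℂ) • twistedTranslation α (g * h) f := by
  ext x
  have h1 : (α x g : ℂ) * (α (x * g) h : ℂ) = (α x (g * h) : ℂ) * (α g h : ℂ) := by
    exact_mod_cast hα x g h
  simp only [twistedTranslation_apply, Pi.smul_apply, smul_eq_mul, mul_assoc]
  rw [← mul_assoc, h1]
  ring

theorem twistedTranslation_one (hα : IsCocycle α) (f : G → ℂ) :
    twistedTranslation α 1 f = (α 1 1 : ℂ) • f := by
  ext x
  simp [twistedTranslation_apply, hα.one_right x]

end Translation

namespace ProjRep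

variable {G : Type*} [Group G] {α : G → G → ℂˣ}

/-! ### Inverses, averaging and Schur's lemma -/

theorem toMatrix_mul (ρ : ProjRep α) (g h : G) :
    ρ.toMatrix g * ρ.toMatrix h = (α g h : ℂ) • ρ.toMatrix (g * h) := ρ.mat_mul g h

theorem isUnit_det_toMatrix (ρ : ProjRep α) (g : G) : IsUnit (ρ.toMatrix g).det :=
  (Matrix.isUnit_iff_isUnit_det _).1 (ρ.mat g).isUnit

theorem toMatrix_one (ρ : ProjRep α) : ρ.toMatrix 1 = (α 1 1 : ℂ) • 1 := by
  have h := ρ.toMatrix_mul 1 1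
  rw [mul_one] at h
  calc ρ.toMatrix 1 = (ρ.toMatrix 1)⁻¹ * (ρ.toMatrix 1 * ρ.toMatrix 1) := by
        rw [Matrix.nonsing_inv_mul_cancel_left _ _ (ρ.isUnit_det_toMatrix 1)]
    _ = _ := by
        rw [h, Matrix.mul_smul, Matrix.nonsing_inv_mul _ (ρ.isUnit_det_toMatrix 1)]

theorem toMatrix_inv_eq (ρ : ProjRep α) (g : G) :
    (ρ.toMatrix g)⁻¹ = ((α g g⁻¹ : ℂ) * (α 1 1 : ℂ))⁻¹ • ρ.toMatrix g⁻¹ := by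
  apply Matrix.inv_eq_right_inv
  rw [Matrix.mul_smul, toMatrix_mul, mul_inv_cancel, toMatrix_one, smul_smul, smul_smul,
    mul_assoc, inv_mul_cancel₀ (mul_ne_zero (α g g⁻¹).ne_zero (α 1 1).ne_zero), one_smul]

theorem inv_mul_inv (ρ : ProjRep α) (g h : G) :
    (ρ.toMatrix h)⁻¹ * (ρ.toMatrix g)⁻¹ = (α g h : ℂ)⁻¹ • (ρ.toMatrix (g * h))⁻¹ := by
  rw [← Matrix.mul_inv_rev, toMatrix_mul]
  apply Matrix.inv_eq_right_inv
  rw [Matrix.smul_mul, Matrix.mul_smul, Matrix.mul_nonsing_inv _ (ρ.isUnit_det_toMatrix _),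
    smul_smul, mul_inv_cancel₀ (α g h).ne_zero, one_smul]

/-- The average of a matrix over the group intertwines the two representations. -/
theorem average_intertwines [Fintype G] (ρ σ : ProjRep α)
    (X : Matrix (Fin ρ.dim) (Fin σ.dim) ℂ) (h : G) :
    (∑ g : G, (ρ.toMatrix g)⁻¹ * X * σ.toMatrix g) * σ.toMatrix h =
      ρ.toMatrix h * ∑ g : G, (ρ.toMatrix g)⁻¹ * X * σ.toMatrix g := by
  have key : (ρ.toMatrix h)⁻¹ * (∑ g : G, (ρ.toMatrix g)⁻¹ * X * σ.toMatrix g) * σ.toMatrix h =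
      ∑ g : G, (ρ.toMatrix g)⁻¹ * X * σ.toMatrix g := by
    rw [Matrix.mul_sum, Matrix.sum_mul]
    refine Fintype.sum_equiv (Equiv.mulRight h) _ _ fun g => ?_
    calc (ρ.toMatrix h)⁻¹ * ((ρ.toMatrix g)⁻¹ * X * σ.toMatrix g) * σ.toMatrix h
        = ((ρ.toMatrix h)⁻¹ * (ρ.toMatrix g)⁻¹) * X * (σ.toMatrix g * σ.toMatrix h) := by
          simp only [Matrix.mul_assoc]
      _ = _ := by
          rw [inv_mul_inv, toMatrix_mul, Matrix.smul_mul, Matrix.smul_mul, Matrix.mul_smul,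
            smul_smul, inv_mul_cancel₀ (α g h).ne_zero, one_smul, Equiv.coe_mulRight]
  conv_rhs => rw [← key]
  rw [Matrix.mul_assoc, Matrix.mul_nonsing_inv_cancel_left _ _ (ρ.isUnit_det_toMatrix h)]

/-- Schur's lemma: an intertwiner between irreducible representations is zero or an
equivalence. -/
theorem eq_zero_of_intertwines {ρ σ : ProjRep α} (hρ : ρ.IsIrreducible) (hσ : σ.IsIrreducible)
    (hne : ¬ ρ.Equivalent σ) (T : Matrix (Fin ρ.dim) (Fin σ.dim) ℂ)
    (hT : ∀ g, T * σ.toMatrix g = ρ.toMatrix g * T) : T = 0 := by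
  have hv (g : G) (v : Fin σ.dim → ℂ) : T *ᵥ (σ.toMatrix g *ᵥ v) = ρ.toMatrix g *ᵥ (T *ᵥ v) := by
    rw [Matrix.mulVec_mulVec, hT, Matrix.mulVec_mulVec]
  have hker := hσ.2 (LinearMap.ker T.mulVecLin) (by
    intro g w hw
    simp only [LinearMap.mem_ker, Matrix.mulVecLin_apply] at hw ⊢
    rw [hv, hw, Matrix.mulVec_zero])
  have hran := hρ.2 (LinearMap.range T.mulVecLin) (by
    rintro g _ ⟨v, rfl⟩
    exact ⟨σ.toMatrix g *ᵥ v, by simp only [Matrix.mulVecLin_apply]; rw [hv]⟩)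
  have hzero (h : T.mulVecLin = 0) : T = 0 := by
    ext i j
    simpa using congrFun (LinearMap.congr_fun h (Pi.single j 1)) i
  rcases hker with hker | hker
  · rcases hran with hran | hran
    · exact hzero (LinearMap.range_eq_bot.1 hran)
    · exact absurd ⟨LinearEquiv.ofBijective T.mulVecLin
        ⟨LinearMap.ker_eq_bot.1 hker, LinearMap.range_eq_top.1 hran⟩, fun g v => hv g v⟩ hne
  · exact hzero (LinearMap.ker_eq_top.1 hker)

/-- Schur's lemma: an endomorphism of an irreducible representation is a scalar. -/
theorem eq_smul_one_of_commutes {ρ : ProjRep α} (hρ : ρ.IsIrreducible)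
    (T : Matrix (Fin ρ.dim) (Fin ρ.dim) ℂ) (hT : ∀ g, T * ρ.toMatrix g = ρ.toMatrix g * T) :
    ∃ c : ℂ, T = c • 1 := by
  -- Positive dimension makes the space nontrivial, so an eigenvalue exists.
  have : NeZero ρ.dim := ⟨hρ.1.ne'⟩
  obtain ⟨c, hc⟩ := Module.End.exists_eigenvalue T.mulVecLin
  refine ⟨c, ?_⟩
  have htop := (hρ.2 (Module.End.eigenspace T.mulVecLin c) (by
    intro g w hw
    rw [Module.End.mem_eigenspace_iff, Matrix.mulVecLin_apply] at hw ⊢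
    rw [Matrix.mulVec_mulVec, hT, ← Matrix.mulVec_mulVec, hw, Matrix.mulVec_smul])).resolve_left hc
  ext i j
  have hj : (Pi.single j 1 : Fin ρ.dim → ℂ) ∈ Module.End.eigenspace T.mulVecLin c :=
    htop ▸ Submodule.mem_top
  rw [Module.End.mem_eigenspace_iff] at hj
  simpa [Matrix.one_apply, Pi.single_apply] using congrFun hj i

theorem Equivalent.refl (ρ : ProjRep α) : ρ.Equivalent ρ :=
  ⟨LinearEquiv.refl ℂ _, fun _ _ => rfl⟩

theorem IsCompleteSet.eq_of_equivalent {R : Set (ProjRep α)} (hR : IsCompleteSet R)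
    {ρ σ : ProjRep α} (hρ : ρ ∈ R) (hσ : σ ∈ R) (h : ρ.Equivalent σ) : ρ = σ :=
  (hR.2 σ (hR.1 σ hσ)).unique ⟨hρ, h⟩ ⟨hσ, Equivalent.refl σ⟩

/-- Averaging a matrix unit isolates one product of coefficients, so Schur's lemma becomes
orthogonality. -/
theorem average_single_apply [Fintype G] (ρ σ : ProjRep α) (k l : Fin ρ.dim) (m n : Fin σ.dim) :
    (∑ g : G, (ρ.toMatrix g)⁻¹ * Matrix.single k m (1 : ℂ) * σ.toMatrix g :
      Matrix (Fin ρ.dim) (Fin σ.dim) ℂ) l n =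
      ∑ g : G, (ρ.toMatrix g)⁻¹ l k * σ.toMatrix g m n := by
  rw [Matrix.sum_apply]
  refine Finset.sum_congr rfl fun g _ => ?_
  rw [Matrix.mul_apply, Finset.sum_eq_single m]
  · simp
  · intro j _ hj
    rw [Matrix.mul_single_apply_of_ne _ _ _ _ _ hj, zero_mul]
  · simp

/-- Schur orthogonality for inequivalent representations. -/
theorem sum_inv_mul_of_not_equivalent [Fintype G] {ρ σ : ProjRep α} (hρ : ρ.IsIrreducible)
    (hσ : σ.IsIrreducible) (hne : ¬ ρ.Equivalent σ) (k l : Fin ρ.dim) (m n : Fin σ.dim) :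
    ∑ g : G, (ρ.toMatrix g)⁻¹ l k * σ.toMatrix g m n = 0 := by
  rw [← average_single_apply, eq_zero_of_intertwines hρ hσ hne _ (average_intertwines ρ σ _),
    Matrix.zero_apply]

/-- Schur orthogonality for the coefficients of one representation. -/
theorem sum_inv_mul_self [Fintype G] {ρ : ProjRep α} (hρ : ρ.IsIrreducible)
    (k l m n : Fin ρ.dim) :
    ∑ g : G, (ρ.toMatrix g)⁻¹ l k * ρ.toMatrix g m n =
      if k = m ∧ l = n then (Fintype.card G : ℂ) / ρ.dim else 0 := by
  have hd : (ρ.dim : ℂ) ≠ 0 := by exact_mod_cast hρ.1.ne'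
  obtain ⟨c, hc⟩ := eq_smul_one_of_commutes hρ _
    (average_intertwines ρ ρ (Matrix.single k m 1))
  -- The scalar is found by taking traces: conjugation preserves the trace of the matrix unit.
  have htr : c * ρ.dim = if k = m then (Fintype.card G : ℂ) else 0 := by
    have h := congrArg Matrix.trace hc
    rw [Matrix.trace_sum, Matrix.trace_smul, Matrix.trace_one, Fintype.card_fin, smul_eq_mul] at h
    rw [← h]
    have hg (g : G) : Matrix.trace ((ρ.toMatrix g)⁻¹ * Matrix.single k m 1 * ρ.toMatrix g) =
        if k = m then 1 else 0 := by
      rw [Matrix.mul_assoc, Matrix.trace_mul_comm, Matrix.mul_assoc,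
        Matrix.mul_nonsing_inv _ (ρ.isUnit_det_toMatrix g), mul_one]
      split_ifs with hkm
      · subst hkm; simp
      · exact Matrix.trace_single_eq_of_ne _ _ _ hkm
    simp only [hg]
    split_ifs <;> simp
  rw [← average_single_apply, hc, Matrix.smul_apply, Matrix.one_apply, smul_eq_mul]
  rw [← eq_div_iff hd] at htr
  rw [htr]
  split_ifs <;> simp_all

theorem IsUnitary.inv_apply {ρ : ProjRep α} (hρ : ρ.IsUnitary) (g : G) (k l : Fin ρ.dim) :
    (ρ.toMatrix g)⁻¹ l k = conj (ρ.toMatrix g k l) := by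
  rw [← hρ g]; rfl

/-- $\alpha(g,h)$ relates two unitary matrices; positive dimension supplies a diagonal entry to read
off. -/
theorem IsUnitary.cocycle_mul_conj {ρ : ProjRep α} (hρ : ρ.IsUnitary) (hd : 0 < ρ.dim)
    (g h : G) : (α g h : ℂ) * conj (α g h : ℂ) = 1 := by
  have hu (g : G) : ρ.toMatrix g * (ρ.toMatrix g)ᴴ = 1 := by
    rw [hρ g, Matrix.mul_nonsing_inv _ (ρ.isUnit_det_toMatrix g)]
  have h1 : (ρ.toMatrix g * ρ.toMatrix h) * (ρ.toMatrix g * ρ.toMatrix h)ᴴ = 1 := by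
    rw [Matrix.conjTranspose_mul, Matrix.mul_assoc, ← Matrix.mul_assoc (ρ.toMatrix h), hu,
      Matrix.one_mul, hu]
  rw [toMatrix_mul, Matrix.conjTranspose_smul, Matrix.smul_mul, Matrix.mul_smul, hu,
    smul_smul] at h1
  simpa using congrFun (congrFun h1 ⟨0, hd⟩) ⟨0, hd⟩

/-! ### Irreducible constituents -/

/-- A nonzero subspace which is invariant under a projective action contains a copy of an
irreducible projective representation. -/
theorem exists_irreducible_of_invariant {V : Type*} [AddCommGroup V] [Module ℂ V]
    [FiniteDimensional ℂ V] (T : G → V →ₗ[ℂ] V)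
    (hmul : ∀ g h v, T g (T h v) = (α g h : ℂ) • T (g * h) v)
    (hone : ∀ v, T 1 v = (α 1 1 : ℂ) • v)
    (W : Submodule ℂ V) (hW : ∀ g, ∀ w ∈ W, T g w ∈ W) (hW0 : W ≠ ⊥) :
    ∃ (σ : ProjRep α) (φ : (Fin σ.dim → ℂ) →ₗ[ℂ] V), σ.IsIrreducible ∧
      Function.Injective φ ∧ (∀ v, φ v ∈ W) ∧ ∀ g v, φ (σ.toMatrix g *ᵥ v) = T g (φ v) := by
  -- A minimal nonzero invariant subspace is irreducible; a basis turns it into matrices.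
  obtain ⟨U, ⟨hUW, hU0, hU⟩, hmin⟩ := (wellFounded_lt (α := Submodule ℂ V)).has_min
    {U | U ≤ W ∧ U ≠ ⊥ ∧ ∀ g, ∀ w ∈ U, T g w ∈ U} ⟨W, le_rfl, hW0, hW⟩
  let e := (Module.finBasis ℂ U).equivFun
  let φ : (Fin (Module.finrank ℂ U) → ℂ) →ₗ[ℂ] V := U.subtype ∘ₗ e.symm.toLinearMap
  have hφ : Function.Injective φ := U.subtype_injective.comp e.symm.injective
  have hφU (v) : φ v ∈ U := (e.symm v).2
  have hsurj {w : V} (hw : w ∈ U) : ∃ v, φ v = w := ⟨e ⟨w, hw⟩, by simp [φ]⟩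
  let A (g : G) : Matrix (Fin (Module.finrank ℂ U)) (Fin (Module.finrank ℂ U)) ℂ :=
    LinearMap.toMatrix' (e.toLinearMap ∘ₗ (T g).restrict (hU g) ∘ₗ e.symm.toLinearMap)
  have hA (g v) : φ (A g *ᵥ v) = T g (φ v) := by
    simp [A, φ, LinearMap.toMatrix'_mulVec]
  have hext {B C : Matrix (Fin (Module.finrank ℂ U)) (Fin (Module.finrank ℂ U)) ℂ}
      (h : ∀ v, φ (B *ᵥ v) = φ (C *ᵥ v)) : B = C := by
    ext i j
    simpa using congrFun (hφ (h (Pi.single j 1))) i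
  have hAmul (g h : G) : A g * A h = (α g h : ℂ) • A (g * h) := by
    refine hext fun v => ?_
    rw [← Matrix.mulVec_mulVec, hA, hA, hmul, Matrix.smul_mulVec, map_smul, hA]
  have hAone : A 1 = (α 1 1 : ℂ) • 1 := by
    refine hext fun v => ?_
    rw [hA, hone, Matrix.smul_mulVec, map_smul, Matrix.one_mulVec]
  have hdet (g : G) : (A g).det ≠ 0 := by
    have h1 : A g * A g⁻¹ = ((α g g⁻¹ : ℂ) * (α 1 1 : ℂ)) • 1 := by
      rw [hAmul, mul_inv_cancel, hAone, smul_smul]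
    have h2 := congrArg Matrix.det h1
    rw [Matrix.det_mul, Matrix.det_smul, Matrix.det_one, mul_one] at h2
    refine left_ne_zero_of_mul (b := (A g⁻¹).det) ?_
    rw [h2]
    exact pow_ne_zero _ (mul_ne_zero (α g g⁻¹).ne_zero (α 1 1).ne_zero)
  let σ : ProjRep α :=
    ⟨_, fun g => Matrix.GeneralLinearGroup.mkOfDetNeZero (A g) (hdet g), hAmul⟩
  refine ⟨σ, φ, ⟨?_, fun X hX => ?_⟩, hφ, fun v => hUW (hφU v), hA⟩
  · exact Module.finrank_pos_iff.2 (Submodule.nontrivial_iff_ne_bot.2 hU0)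
  · by_cases hX0 : X = ⊥
    · exact Or.inl hX0
    right
    have hle : X.map φ ≤ U := by
      rintro _ ⟨v, -, rfl⟩
      exact hφU v
    have hmap : X.map φ = U := by
      by_contra hne
      refine hmin (X.map φ) ⟨hle.trans hUW, ?_, ?_⟩ (lt_of_le_of_ne hle hne)
      · rwa [Ne, ← Submodule.map_bot φ, (Submodule.map_injective_of_injective hφ).eq_iff]
      · rintro g _ ⟨v, hv, rfl⟩
        exact ⟨_, hX g v hv, hA g v⟩
    rw [eq_top_iff]
    intro v _
    obtain ⟨x, hx, hxv⟩ : φ v ∈ X.map φ := by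
      rw [hmap]
      exact hφU v
    exact hφ hxv ▸ hx

variable [Fintype G]

/-! ### Orthonormality and completeness of the coefficients -/

/-- Schur orthogonality for the members of a complete set, as orthonormality of the columns of
the coefficient matrix. -/
theorem conjTranspose_mul_coeffMatrix {R : Set (ProjRep α)} (hR : IsCompleteSet R)
    (hU : ∀ ρ ∈ R, ρ.IsUnitary) : (coeffMatrix R)ᴴ * coeffMatrix R = 1 := by
  ext ⟨⟨⟨ρ, hρ⟩, k⟩, l⟩ ⟨⟨⟨σ, hσ⟩, m⟩, n⟩
  have hentry : ((coeffMatrix R)ᴴ * coeffMatrix R) ⟨⟨⟨ρ, hρ⟩, k⟩, l⟩ ⟨⟨⟨σ, hσ⟩, m⟩, n⟩ =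
      (Real.sqrt ((ρ.dim : ℝ) / Fintype.card G) : ℂ) *
        (Real.sqrt ((σ.dim : ℝ) / Fintype.card G) : ℂ) *
          ∑ g : G, (ρ.toMatrix g)⁻¹ l k * σ.toMatrix g m n := by
    rw [Matrix.mul_apply, Finset.mul_sum]
    refine Finset.sum_congr rfl fun g _ => ?_
    rw [(hU ρ hρ).inv_apply]
    simp only [coeffMatrix, Matrix.conjTranspose_apply, RCLike.star_def, map_mul,
      Complex.conj_ofReal]
    ring
  rw [hentry]
  by_cases h : ρ = σ
  · subst h
    rw [sum_inv_mul_self (hR.1 ρ hρ)]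
    have hd : (ρ.dim : ℂ) ≠ 0 := by exact_mod_cast (hR.1 ρ hρ).1.ne'
    have hG : (Fintype.card G : ℂ) ≠ 0 := by exact_mod_cast Fintype.card_ne_zero
    rw [← Complex.ofReal_mul, Real.mul_self_sqrt (by positivity)]
    by_cases hkl : k = m ∧ l = n
    · obtain ⟨rfl, rfl⟩ := hkl
      simp only [and_self, if_true, Matrix.one_apply_eq]
      push_cast
      field_simp
    · rw [if_neg hkl, mul_zero, Matrix.one_apply_ne]
      intro heq
      simp only [Sigma.mk.injEq, true_and, heq_eq_eq] at heq
      apply hkl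
      obtain ⟨h1, h2⟩ := heq
      subst h1
      simpa using h2
  · rw [sum_inv_mul_of_not_equivalent (hR.1 ρ hρ) (hR.1 σ hσ)
      (fun he => h (hR.eq_of_equivalent hρ hσ he)), mul_zero, Matrix.one_apply_ne]
    intro heq
    exact h (congrArg (fun c => c.1.1.1) heq)

/-- Orthonormal columns are independent in $\mathbb{C}^G$, and each $\rho$ owns at least one of
them. -/
theorem IsCompleteSet.finite {R : Set (ProjRep α)} (hR : IsCompleteSet R)
    (hU : ∀ ρ ∈ R, ρ.IsUnitary) : R.Finite := by
  have hE := conjTranspose_mul_coeffMatrix hR hU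
  have hli : LinearIndependent ℂ (fun c => WithLp.toLp 2 (fun g => coeffMatrix R g c) :
      _ → EuclideanSpace ℂ G) := by
    apply Orthonormal.linearIndependent
    rw [orthonormal_iff_ite]
    intro c c'
    have h := congrFun (congrFun hE c) c'
    rw [Matrix.one_apply] at h
    rw [← h, Matrix.mul_apply]
    simp [PiLp.inner_apply, mul_comm]
  have := hli.finite
  refine Set.finite_coe_iff.1 (Finite.of_injective
    (fun ρ : R => (⟨⟨ρ, ⟨0, (hR.1 ρ.1 ρ.2).1⟩⟩, ⟨0, (hR.1 ρ.1 ρ.2).1⟩⟩ :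
      Σ p : (Σ ρ : R, Fin ρ.1.dim), Fin p.1.1.dim)) fun ρ σ h => ?_)
  exact congrArg (fun c => c.1.1) h

/-- The functions orthogonal to all matrix coefficients of `ρ` are stable under twisted
translation. -/
theorem IsUnitary.sum_conj_mul_translation {ρ : ProjRep α} (hρ : ρ.IsUnitary) {f : G → ℂ}
    (hf : ∀ k l, ∑ x : G, conj (ρ.toMatrix x k l) * f x = 0) (g : G) (k l : Fin ρ.dim) :
    ∑ x : G, conj (ρ.toMatrix x k l) * twistedTranslation α g f x = 0 := by
  have hx (x : G) : conj (ρ.toMatrix x k l) * twistedTranslation α g f x =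
      ∑ j, (ρ.toMatrix g) l j * (conj (ρ.toMatrix (x * g) k j) * f (x * g)) := by
    -- The factor $\alpha(x,g)^{-1}$ cancels the one in the twisted translation.
    have h1 : (ρ.toMatrix x)⁻¹ =
        (α x g : ℂ)⁻¹ • (ρ.toMatrix g * (ρ.toMatrix (x * g))⁻¹) := by
      rw [← Matrix.mul_smul, ← inv_mul_inv,
        Matrix.mul_nonsing_inv_cancel_left _ _ (ρ.isUnit_det_toMatrix g)]
    have h2 := congrFun (congrFun h1 l) k
    rw [Matrix.smul_apply, Matrix.mul_apply, smul_eq_mul] at h2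
    simp only [hρ.inv_apply] at h2
    have h3 : (α x g : ℂ) ≠ 0 := (α x g).ne_zero
    calc conj (ρ.toMatrix x k l) * twistedTranslation α g f x
        = (∑ j, ρ.toMatrix g l j * conj (ρ.toMatrix (x * g) k j)) * f (x * g) := by
          rw [h2, twistedTranslation_apply]
          field_simp
      _ = _ := by
          rw [Finset.sum_mul]
          exact Finset.sum_congr rfl fun j _ => mul_assoc _ _ _
  simp only [hx]
  rw [Finset.sum_comm]
  refine Finset.sum_eq_zero fun j _ => ?_
  rw [← Finset.mul_sum]
  have h := (Equiv.sum_comp (Equiv.mulRight g) fun y => conj (ρ.toMatrix y k j) * f y).trans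
    (hf k j)
  simp only [Equiv.coe_mulRight] at h
  rw [h, mul_zero]

/-- The coefficients of a complete set of irreducible representations span all functions. -/
theorem eq_zero_of_orthogonal (hα : IsCocycle α) {R : Set (ProjRep α)} (hR : IsCompleteSet R)
    (hU : ∀ ρ ∈ R, ρ.IsUnitary) {f : G → ℂ}
    (hf : ∀ ρ ∈ R, ∀ k l, ∑ x : G, conj (ρ.toMatrix x k l) * f x = 0) : f = 0 := by
  let W : Submodule ℂ (G → ℂ) :=
    { carrier := {f | ∀ ρ ∈ R, ∀ k l, ∑ x : G, conj (ρ.toMatrix x k l) * f x = 0}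
      zero_mem' := by simp
      add_mem' := by
        intro a b ha hb ρ hρ k l
        simp only [Pi.add_apply, mul_add, Finset.sum_add_distrib, ha ρ hρ k l, hb ρ hρ k l,
          add_zero]
      smul_mem' := by
        intro c a ha ρ hρ k l
        simp only [Pi.smul_apply, smul_eq_mul, mul_left_comm _ c, ← Finset.mul_sum, ha ρ hρ k l,
          mul_zero] }
  by_contra hf0
  have hW0 : W ≠ ⊥ := fun h => hf0 ((Submodule.mem_bot ℂ).1 (h ▸ (hf : f ∈ W)))
  obtain ⟨σ, φ, hσ, hφ, hφW, hφT⟩ := exists_irreducible_of_invariant (twistedTranslation α)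
    (twistedTranslation_comp hα) (twistedTranslation_one hα) W
    (fun g w hw ρ hρ k l => (hU ρ hρ).sum_conj_mul_translation (hw ρ hρ) g k l) hW0
  obtain ⟨ρ, ⟨hρ, S, hS⟩, -⟩ := hR.2 σ hσ
  have hS' (g : G) (v) : S.symm (ρ.toMatrix g *ᵥ v) = σ.toMatrix g *ᵥ S.symm v := by
    rw [LinearEquiv.symm_apply_eq, hS, LinearEquiv.apply_symm_apply]
  -- Evaluation at $1$, in coordinates: $(T_gf)(1)=\alpha(1,1)f(g)$ recovers $f$ from its
  -- translates.
  let b : Fin ρ.dim → ℂ := fun k => φ (S.symm (Pi.single k 1)) 1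
  have hcoef (v : Fin ρ.dim → ℂ) (g : G) :
      (α 1 1 : ℂ) * φ (S.symm v) g = ∑ k, (ρ.toMatrix g *ᵥ v) k * b k := by
    have h1 : (α 1 1 : ℂ) * φ (S.symm v) g = φ (S.symm (ρ.toMatrix g *ᵥ v)) 1 := by
      rw [hS', hφT, twistedTranslation_apply, hα.one_left g, one_mul]
    rw [h1]
    conv_lhs => rw [pi_eq_sum_univ' (ρ.toMatrix g *ᵥ v)]
    simp only [map_sum, map_smul, Finset.sum_apply, Pi.smul_apply, smul_eq_mul, b]
  have hzero (v : Fin ρ.dim → ℂ) : φ (S.symm v) = 0 := by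
    have horth := hφW (S.symm v) ρ hρ
    have hsq : ∑ g : G, conj ((α 1 1 : ℂ) * φ (S.symm v) g) * φ (S.symm v) g = 0 := by
      simp only [hcoef, map_sum, Matrix.mulVec, dotProduct, Finset.sum_mul, map_mul]
      rw [Finset.sum_comm]
      refine Finset.sum_eq_zero fun k _ => ?_
      rw [Finset.sum_comm]
      refine Finset.sum_eq_zero fun l _ => ?_
      rw [← mul_zero (conj (v l) * conj (b k)), ← horth k l, Finset.mul_sum]
      refine Finset.sum_congr rfl fun g _ => ?_
      ring
    simp only [map_mul, mul_assoc, ← Finset.mul_sum] at hsq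
    have hsq' := (mul_eq_zero.1 hsq).resolve_left (by simp)
    have hnorm : ∑ g : G, Complex.normSq (φ (S.symm v) g) = 0 := by
      simp only [← Complex.normSq_eq_conj_mul_self] at hsq'
      exact_mod_cast hsq'
    ext g
    exact Complex.normSq_eq_zero.1 ((Finset.sum_eq_zero_iff_of_nonneg
      fun _ _ => Complex.normSq_nonneg _).1 hnorm g (Finset.mem_univ g))
  have hd := (hR.1 ρ hρ).1
  have h1 := hzero (Pi.single ⟨0, hd⟩ 1)
  rw [map_eq_zero_iff _ hφ, map_eq_zero_iff _ S.symm.injective] at h1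
  simpa using congrFun h1 ⟨0, hd⟩

theorem coeffMatrix_mul_conjTranspose (hα : IsCocycle α) {R : Set (ProjRep α)}
    (hR : IsCompleteSet R) (hU : ∀ ρ ∈ R, ρ.IsUnitary) [Fintype R] :
    coeffMatrix R * (coeffMatrix R)ᴴ = 1 := by
  have hE := conjTranspose_mul_coeffMatrix hR hU
  rw [← sub_eq_zero]
  have hker : (coeffMatrix R)ᴴ * (coeffMatrix R * (coeffMatrix R)ᴴ - 1) = 0 := by
    rw [Matrix.mul_sub, ← Matrix.mul_assoc, hE, Matrix.one_mul, Matrix.mul_one, sub_self]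
  ext g h
  refine congrFun (eq_zero_of_orthogonal hα hR hU
    (f := fun x => (coeffMatrix R * (coeffMatrix R)ᴴ - 1 : Matrix G G ℂ) x h) fun ρ hρ k l => ?_) g
  have h1 := congrFun (congrFun hker ⟨⟨⟨ρ, hρ⟩, k⟩, l⟩) h
  rw [Matrix.mul_apply, Matrix.zero_apply] at h1
  have hcol (x : G) : (coeffMatrix R)ᴴ ⟨⟨⟨ρ, hρ⟩, k⟩, l⟩ x =
      (Real.sqrt ((ρ.dim : ℝ) / Fintype.card G) : ℂ) * conj (ρ.toMatrix x k l) := by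
    simp only [Matrix.conjTranspose_apply, coeffMatrix, RCLike.star_def, map_mul,
      Complex.conj_ofReal]
  simp only [hcol, mul_assoc] at h1
  rw [← Finset.mul_sum] at h1
  refine (mul_eq_zero.1 h1).resolve_left ?_
  have hd : 0 < ρ.dim := (hR.1 ρ hρ).1
  have hG : 0 < Fintype.card G := Fintype.card_pos
  have : 0 < Real.sqrt ((ρ.dim : ℝ) / Fintype.card G) := by positivity
  exact_mod_cast this.ne'

/-! ### Fourier transform and block diagonalisation -/

theorem fourier_eq_sum_inv (f : G → ℂ) (ρ : ProjRep α) :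
    fourier f ρ = ∑ a : G, f a • (ρ.toMatrix a)⁻¹ := by
  refine Finset.sum_congr rfl fun a _ => ?_
  rw [toMatrix_inv_eq, smul_smul, div_eq_mul_inv]

/-- The `(G,α)`-matrix acts on a conjugated column of the coefficient matrix through the Fourier
transform. -/
theorem twistedGroupMatrix_mul_conj {R : Set (ProjRep α)} (hR : IsCompleteSet R)
    (hU : ∀ ρ ∈ R, ρ.IsUnitary) (ν : G → ℂ) (g : G) (p : Σ ρ : R, Fin ρ.1.dim)
    (n : Fin p.1.1.dim) :
    (twistedGroupMatrix α ν * (coeffMatrix R).map conj) g ⟨p, n⟩ =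
      ∑ j, conj (coeffMatrix R g ⟨p, j⟩) * fourier ν p.1.1 n j := by
  obtain ⟨⟨σ, hσ⟩, m⟩ := p
  change Fin σ.dim at n m
  -- Here $|\alpha(g,a)|=1$ trades $\overline{\alpha(g,a)}^{-1}$ for $\alpha(g,a)$, which the
  -- denominator cancels.
  have hcoc (a : G) : conj (σ.toMatrix (g * a) m n) / (α g a : ℂ) =
      ∑ j, conj (σ.toMatrix g m j) * (σ.toMatrix a)⁻¹ n j := by
    have h := congrArg conj (congrFun (congrFun (σ.toMatrix_mul g a) m) n)
    rw [Matrix.mul_apply, Matrix.smul_apply, smul_eq_mul, map_sum, map_mul] at h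
    simp only [map_mul, ← (hU σ hσ).inv_apply a] at h
    rw [h, div_eq_iff (α g a).ne_zero, mul_right_comm, mul_comm (conj _),
      (hU σ hσ).cocycle_mul_conj (hR.1 σ hσ).1, one_mul]
  let s : ℂ := (Real.sqrt ((σ.dim : ℝ) / Fintype.card G) : ℂ)
  calc (twistedGroupMatrix α ν * (coeffMatrix R).map conj) g ⟨⟨⟨σ, hσ⟩, m⟩, n⟩
      = ∑ a : G, s * ν a * (conj (σ.toMatrix (g * a) m n) / (α g a : ℂ)) := by
        rw [Matrix.mul_apply, ← Equiv.sum_comp (Equiv.mulLeft g)]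
        refine Finset.sum_congr rfl fun a _ => ?_
        simp only [Equiv.coe_mulLeft, twistedGroupMatrix, inv_mul_cancel_left, Matrix.map_apply,
          coeffMatrix, map_mul, Complex.conj_ofReal, s]
        ring
    _ = ∑ j, conj (coeffMatrix R g ⟨⟨⟨σ, hσ⟩, m⟩, j⟩) * fourier ν σ n j := by
        simp only [hcoc, fourier_eq_sum_inv, Matrix.sum_apply, Matrix.smul_apply, smul_eq_mul,
          Finset.mul_sum, coeffMatrix, map_mul, Complex.conj_ofReal]
        rw [Finset.sum_comm]
        refine Finset.sum_congr rfl fun j _ => Finset.sum_congr rfl fun a _ => ?_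
        ring

end ProjRep

theorem mainTheorem1 {G : Type*} [Group G] [Fintype G]
    (α : G → G → ℂˣ) (hα : IsCocycle α)
    (R : Set (ProjRep α)) (hR : ProjRep.IsCompleteSet R)
    (hU : ∀ ρ ∈ R, ρ.IsUnitary) :
    R.Finite ∧
    (ProjRep.coeffMatrix R)ᴴ * ProjRep.coeffMatrix R = 1 ∧
    (∀ [Fintype R], ProjRep.coeffMatrix R * (ProjRep.coeffMatrix R)ᴴ = 1) ∧
    ∀ ν : G → ℂ,
      ((ProjRep.coeffMatrix R).map conj)ᴴ * twistedGroupMatrix α ν *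
          (ProjRep.coeffMatrix R).map conj =
        Matrix.blockDiagonal'
          (fun p : (Σ ρ : R, Fin ρ.1.dim) => (ProjRep.fourier ν p.1.1)ᵀ) := by
  have hE := ProjRep.conjTranspose_mul_coeffMatrix hR hU
  refine ⟨hR.finite hU, hE, ProjRep.coeffMatrix_mul_conjTranspose hα hR hU, fun ν => ?_⟩
  ext ⟨p, l⟩ ⟨q, n⟩
  have horth (j : Fin q.1.1.dim) :
      ∑ g : G, ProjRep.coeffMatrix R g ⟨p, l⟩ * conj (ProjRep.coeffMatrix R g ⟨q, j⟩) =
        if (⟨p, l⟩ : Σ p : (Σ ρ : R, Fin ρ.1.dim), Fin p.1.1.dim) = ⟨q, j⟩ then 1 else 0 := by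
    have h := congrArg conj (congrFun (congrFun hE ⟨p, l⟩) ⟨q, j⟩)
    rw [Matrix.mul_apply, Matrix.one_apply, map_sum] at h
    simpa [apply_ite] using h
  have hentry : (((ProjRep.coeffMatrix R).map conj)ᴴ * twistedGroupMatrix α ν *
      (ProjRep.coeffMatrix R).map conj) ⟨p, l⟩ ⟨q, n⟩ =
      ∑ j, ProjRep.fourier ν q.1.1 n j *
        if (⟨p, l⟩ : Σ p : (Σ ρ : R, Fin ρ.1.dim), Fin p.1.1.dim) = ⟨q, j⟩ then 1 else 0 := by
    rw [Matrix.mul_assoc, Matrix.mul_apply]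
    simp only [ProjRep.twistedGroupMatrix_mul_conj hR hU, Finset.mul_sum, ← horth]
    rw [Finset.sum_comm]
    refine Finset.sum_congr rfl fun j _ => Finset.sum_congr rfl fun g _ => ?_
    simp only [Matrix.conjTranspose_apply, Matrix.map_apply, RCLike.star_def, Complex.conj_conj]
    ring
  rw [hentry]
  by_cases hpq : p = q
  · subst hpq
    simp [Matrix.blockDiagonal'_apply_eq]
  · rw [Matrix.blockDiagonal'_apply_ne _ _ _ hpq]
    refine Finset.sum_eq_zero fun j _ => ?_
    rw [if_neg (fun h => hpq (congrArg Sigma.fst h)), mul_zero]
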